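/- Conventions. Work in $\mathbb{R}^2$ with the Euclidean distance; $B(z,r)$ is the open disk. A bijection $f$ of a metric space $M$ onto itself is $L$-bi-Lipschitz if $L^{-1}d(x,y)\le d(f(x),f(y))\le L\,d(x,y)$ for all $x,y\in M$, and $\mathrm{LIP}(M)$ is the class of maps that are so for some $L\ge 1$. A map $H:[0,1]\to \mathrm{LIP}(M)$, $t\mapsto H_t$, is a bi-Lipschitz path if for every $\epsilon'>0$ there is $\delta'>0$ such that, whenever $|s-t|<\delta'$, we have $d(H_s\circ H_t^{-1}(x),x)<\epsilon'$ for all $x\in M$ and $H_s\circ H_t^{-1}$ is $(1+\epsilon')$-bi-Lipschitz. A set $X\subset\mathbb{R}^2$ is $(C,s)$-homogeneous if for every bounded $A\subset X$, every $\epsilon'\in(0,\operatorname{diam}A)$ and every $V\subset A$ whose distinct points have mutual distance at least $\epsilon'$, we have $\operatorname{card}V\le C(\epsilon'^{-1}\operatorname{diam}A)^s$. For $\alpha>0$ and $W\subset\mathbb{R}^2$, $W^{\alpha}$ is the union of the squares $\alpha\mathbf{n}+[0,\alpha]^2$, $\mathbf{n}\in\mathbb{Z}^2$, that intersect $W$;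 the $\delta$-square thickening of $W$ is $\mathcal{T}_\delta(W)=(W^{4\delta})^{\delta}$. Proposition 4.1. Let $C>0$, $c\ge 1$, $s\in[0,1)$, $\eta\in(0,1)$ and $\epsilon>0$. There exists $\delta>0$, depending only on $C,c,s,\eta,\epsilon$, with the following property. Let $\Omega\subset\mathbb{R}^2$ be a domain with $\operatorname{diam}\Omega=1$ such that for any $x,y\in\Omega$ there is a path $\gamma_{x,y}:[0,1]\to\Omega$ from $x$ to $y$ with \[ \operatorname{dist}(\gamma_{x,y},\partial\Omega)\ge (2c)^{-1}\min\{\operatorname{dist}(x,\partial\Omega),\operatorname{dist}(y,\partial\Omega)\}. \] (a) If $z,w\in\Omega$ have distance at least $2c\epsilon$ from $\partial\Omega$, then the disk $B(z,\epsilon)$ can be deformed continuously and isometrically to $B(w,\epsilon)$ in $\Omega$, that is, there is a continuous map $\varphi:[0,1]\times B(z,\epsilon)\to\Omega$ such that every $\varphi(t,\cdot)$ preserves distances, $\varphi(0,\cdot)$ is the inclusion, and $\varphi(1,\cdot)$ maps $B(z,\epsilon)$ onto $B(w,\epsilon)$. (b) Let $X\subset\Omega$ be $(C,s)$-homogeneous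 with $\operatorname{dist}(X,\partial\Omega)>\eta$. Then $\mathcal{T}_\delta(X)\subset\Omega$, and for every disk $B=B(z,\epsilon)$ with $z\in\Omega$ and $\operatorname{dist}(z,\partial\Omega)\ge 2\epsilon$ there exists a bi-Lipschitz path $H:[0,1]\to\mathrm{LIP}(\Omega)$, where $\Omega$ carries the Euclidean distance, such that $H_0$ is the identity and (i) $H_1$ maps $\mathcal{T}_\delta(X)$ into $B$; (ii) for each $t\in[0,1]$ and each connected component $D$ of $\mathcal{T}_\delta(X)$, the restriction $H_t|_D$ preserves distances. -/

import Mathlib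

open Set Metric

noncomputable section

/-- The Euclidean plane. -/
abbrev Plane : Type := EuclideanSpace ℝ (Fin 2)

/-- The distance `inf {|a - b| : a ∈ A, b ∈ B}` between two sets, with value `∞` if one of them
is empty. -/
def setEDist (A B : Set Plane) : ENNReal := ⨅ a ∈ A, ⨅ b ∈ B, edist a b

/-- `f` is `L`-bi-Lipschitz, that is, `L⁻¹ d(x,y) ≤ d(f x, f y) ≤ L d(x,y)`. -/
def IsBiLipschitz {M N : Type*} [MetricSpace M] [MetricSpace N] (L : ℝ) (f : M → N) : Prop :=
  ∀ x y : M, L⁻¹ * dist x y ≤ dist (f x) (f y) ∧ dist (f x) (f y) ≤ L * dist x y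

/-- The class `LIP(M)` of bi-Lipschitz homeomorphisms of `M` onto itself. (An orientation
condition makes no sense on a general metric space; for paths of homeomorphisms of a planar domain
that start at the identity it holds automatically.) -/
def LIP (M : Type*) [MetricSpace M] : Type _ :=
  {f : M ≃ₜ M // ∃ L : ℝ, 1 ≤ L ∧ IsBiLipschitz L f}

/-- `H : [0,1] → LIP(M)` is a bi-Lipschitz path: for every `ε > 0` there is `δ > 0` such that
`H_s ∘ H_t⁻¹` is `ε`-close to the identity and `(1+ε)`-bi-Lipschitz whenever `|s - t| < δ`. -/
def IsBiLipschitzPath {M : Type*} [MetricSpace M] (H : unitInterval → LIP M) : Prop :=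
  ∀ ε : ℝ, 0 < ε → ∃ δ : ℝ, 0 < δ ∧ ∀ s t : unitInterval, |(s : ℝ) - (t : ℝ)| < δ →
    (∀ x : M, dist ((H s).1 ((H t).1.symm x)) x < ε) ∧
    IsBiLipschitz (1 + ε) (fun x : M => (H s).1 ((H t).1.symm x))

/-- `V` is `ε`-separated. -/
def IsSepSet (ε : ℝ) (V : Set Plane) : Prop :=
  ∀ x ∈ V, ∀ y ∈ V, x ≠ y → ε ≤ dist x y

/-- `X` is `(C,s)`-homogeneous. -/
def IsHomogeneousSet (C s : ℝ) (X : Set Plane) : Prop :=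
  ∀ A ⊆ X, Bornology.IsBounded A → ∀ ε : ℝ, 0 < ε → ε < diam A →
    ∀ V ⊆ A, IsSepSet ε V → V.Finite ∧ (V.ncard : ℝ) ≤ C * (ε⁻¹ * diam A) ^ s

/-- The closed square `α n + [0,α]²` of the grid of mesh `α`. -/
def gridSquare (α : ℝ) (n : Fin 2 → ℤ) : Set Plane :=
  {p | ∀ i, α * (n i : ℝ) ≤ p i ∧ p i ≤ α * (n i : ℝ) + α}

/-- The union `W^α` of the squares of the grid of mesh `α` that intersect `W`. -/
def squareHull (α : ℝ) (W : Set Plane) : Set Plane :=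
  ⋃ n ∈ {n : Fin 2 → ℤ | (gridSquare α n ∩ W).Nonempty}, gridSquare α n

/-- The `δ`-square thickening `T_δ(W) = (W^{4δ})^δ`. -/
def squareThickening (δ : ℝ) (W : Set Plane) : Set Plane :=
  squareHull δ (squareHull (4 * δ) W)

/-- The cigar condition with constant `c`: any two points `x, y` of `Ω` are joined by a path in
`Ω` whose distance from `∂Ω` is at least `(2c)⁻¹ min (dist(x,∂Ω), dist(y,∂Ω))`. -/
def IsCigar (c : ℝ) (Ω : Set Plane) : Prop :=
  ∀ x ∈ Ω, ∀ y ∈ Ω, ∃ γ : Path x y, (∀ t, γ t ∈ Ω) ∧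
    ∀ t, (2 * c)⁻¹ * min (infDist x (frontier Ω)) (infDist y (frontier Ω))
      ≤ infDist (γ t) (frontier Ω)

/-- The disk `B(z,r)` can be deformed continuously and isometrically to `B(w,r)` inside `Ω`. -/
def DiskDeforms (Ω : Set Plane) (r : ℝ) (z w : Plane) : Prop :=
  ∃ φ : unitInterval × Plane → Plane,
    ContinuousOn φ (univ ×ˢ ball z r) ∧
    (∀ t, ∀ p ∈ ball z r, φ (t, p) ∈ Ω) ∧
    (∀ t, ∀ p ∈ ball z r, ∀ q ∈ ball z r, dist (φ (t, p)) (φ (t, q)) = dist p q) ∧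
    (∀ p ∈ ball z r, φ (0, p) = p) ∧
    (fun p => φ (1, p)) '' ball z r = ball w r

end

/-! Part (a) needs only translations: along a cigar path from `z` to `w` the distance to the
frontier stays at least `ε`, so the disk can be carried along the path.

For (b), the thickening of a homogeneous set is covered by `N ≤ 1 + C δ ^ (-s)` boxes of side `12
δ`, and since `s < 1` their total side length tends to 0 with `δ`. Fix a mesh `κ`, small in terms of
`η`, `ε` and `c`, and then `δ` so small that all boxes laid side by side fit into one cell. By
pigeonhole (`exists_offset`) the grid of mesh `κ` can be shifted so that no box meets a grid line.

The basic move (`exists_merge`) empties a cell into a neighbour. Project the boxes to the axis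
joining the two cells. The projections have total length below `κ`, so there is enough gap to be
squeezed, as in an accordion, until everything lies in the target half, while each projection moves
rigidly (`exists_push_right`). Cut off in the other coordinate, this becomes a bi-Lipschitz shear
supported in the two cells that translates every box (`exists_shear_isotopy`), so it can be
repeated.

The cigar condition links the cell of every box to the cell of `z` by a chain of cells in `Ω`
(`Path.reflTransGen_cellStep`). Emptying cells along the chains (`exists_gather`) collects all boxes
near `z`. Boxes may overlap and components may spread over several boxes; this is harmless, because
a continuous map that translates each of finitely many sets displaces a connected subset of their
union by a single vector (`dist_eq_of_translates`). -/

noncomputable section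

/-! ### Disks inside `Ω` and coordinate estimates -/

/-- A disk around a point of `Ω` that does not reach the frontier is contained in `Ω`. -/
theorem ball_subset_of_le_infDist_frontier {Ω : Set Plane} (hΩ : IsOpen Ω) {x : Plane} {r : ℝ}
    (hx : x ∈ Ω) (hr : r ≤ infDist x (frontier Ω)) : ball x r ⊆ Ω := by
  intro y hy
  by_contra hyΩ
  have hr0 : 0 < r := pos_of_mem_ball hy
  have hfr : ∀ p ∈ ball x r, p ∉ frontier Ω := by
    intro p hp hpf
    have := infDist_le_dist_of_mem hpf (x := x)
    rw [mem_ball, dist_comm] at hp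
    linarith
  have hcov : ∀ p ∈ ball x r, p ∉ Ω → p ∈ (closure Ω)ᶜ := fun p hp hpΩ hpc =>
    hfr p hp ⟨hpc, by rwa [hΩ.interior_eq]⟩
  -- Without frontier points, `Ω` and the complement of its closure would disconnect the disk.
  obtain ⟨p, -, hp, hp'⟩ := (convex_ball x r).isPreconnected Ω (closure Ω)ᶜ hΩ
    isClosed_closure.isOpen_compl (fun p hp => or_iff_not_imp_left.2 (hcov p hp))
    ⟨x, mem_ball_self hr0, hx⟩ ⟨y, hy, hcov y hy hyΩ⟩
  exact hp' (subset_closure hp)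

theorem diskDeforms_of_path {Ω : Set Plane} {r : ℝ} {z w : Plane} (γ : Path z w)
    (h : ∀ t, ball (γ t) r ⊆ Ω) : DiskDeforms Ω r z w := by
  refine ⟨fun q => q.2 + (γ q.1 - z), ?_, ?_, ?_, ?_, ?_⟩
  · exact (by fun_prop : Continuous fun q : unitInterval × Plane => q.2 + (γ q.1 - z)).continuousOn
  · intro t p hp
    apply h t
    rw [mem_ball, dist_eq_norm] at hp ⊢
    rwa [show p + (γ t - z) - γ t = p - z by abel]
  · intro t p _ q _
    exact dist_add_right _ _ _
  · intro p _
    simp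
  · ext p
    simp only [Path.target, mem_image]
    constructor
    · rintro ⟨q, hq, rfl⟩
      rw [mem_ball, dist_eq_norm] at hq ⊢
      rwa [show q + (w - z) - w = q - z by abel]
    · intro hp
      refine ⟨p - (w - z), ?_, by abel⟩
      rw [mem_ball, dist_eq_norm] at hp ⊢
      rwa [show p - (w - z) - z = p - w by abel]

theorem dist_le_abs_add_abs (p q : Plane) : dist p q ≤ |p 0 - q 0| + |p 1 - q 1| := by
  rw [EuclideanSpace.dist_eq]
  apply Real.sqrt_le_iff.2
  refine ⟨by positivity, ?_⟩
  simp only [Fin.sum_univ_two, Real.dist_eq]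
  nlinarith [abs_nonneg (p 0 - q 0), abs_nonneg (p 1 - q 1)]

theorem abs_sub_le_dist (p q : Plane) (i : Fin 2) : |p i - q i| ≤ dist p q := by
  rw [dist_eq_norm]
  exact PiLp.norm_apply_le (p - q) i

/-- Used to compare a shear with its source: the shear changes only coordinate `i`, so the
transverse distance survives. -/
theorem dist_le_dist_of_forall_ne {p q p' q' : Plane} {i : Fin 2}
    (hi : p i = q i) (h : ∀ j ≠ i, p j = p' j ∧ q j = q' j) : dist p q ≤ dist p' q' := by
  rw [EuclideanSpace.dist_eq, EuclideanSpace.dist_eq]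
  apply Real.sqrt_le_sqrt
  apply Finset.sum_le_sum
  intro j _
  by_cases hj : j = i
  · subst hj
    rw [hi, dist_self]
    simp
  · rw [(h j hj).1, (h j hj).2]

theorem ofReal_lt_setEDist_infDist {A B : Set Plane} {r : ℝ} (hB : B.Nonempty)
    (h : ENNReal.ofReal r < setEDist A B) {a : Plane} (ha : a ∈ A) : r ≤ infDist a B := by
  rw [le_infDist hB]
  intro b hb
  have h1 : setEDist A B ≤ edist a b := iInf₂_le_of_le a ha (iInf₂_le b hb)
  have h2 := h.trans_le h1
  rw [edist_dist] at h2
  exact (ENNReal.lt_ofReal_iff_toReal_lt (by simp)).1 h2 |>.le |> fun h => by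
    rcases le_total 0 r with hr | hr
    · rwa [ENNReal.toReal_ofReal hr] at h
    · exact hr.trans dist_nonneg

/-- The bound adds the two side lengths `4 δ` and `δ`. -/
theorem squareThickening_near {δ : ℝ} {X : Set Plane} {p : Plane}
    (hp : p ∈ squareThickening δ X) : ∃ x ∈ X, ∀ i, |p i - x i| ≤ 5 * δ := by
  simp only [squareThickening, squareHull, mem_iUnion, exists_prop, mem_ofPred_eq] at hp
  obtain ⟨n, ⟨y, hyn, hy⟩, hpn⟩ := hp
  simp only [mem_iUnion, exists_prop] at hy
  obtain ⟨m, ⟨x, hxm, hx⟩, hym⟩ := hy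
  refine ⟨x, hx, fun i => ?_⟩
  have h1 := hyn i
  have h2 := hpn i
  have h3 := hxm i
  have h4 := hym i
  rw [abs_le]
  constructor <;> linarith

/-! ### Finite nets and the choice of a grid offset -/

/-- Every homogeneous set of diameter at most one is `δ`-covered by at most `1 + C δ ^ (-s)` of its
points. -/
theorem IsHomogeneousSet.exists_finite_net {C s δ : ℝ} {X : Set Plane} (hX : IsHomogeneousSet C s X)
    (hb : Bornology.IsBounded X) (hC : 0 ≤ C) (hs : 0 ≤ s) (hd : diam X ≤ 1) (hδ : 0 < δ) :
    ∃ V : Finset Plane, (V : Set Plane) ⊆ X ∧ (V.card : ℝ) ≤ 1 + C * (δ⁻¹) ^ s ∧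
      ∀ x ∈ X, ∃ v ∈ V, dist x v ≤ δ := by
  have hpow : 0 ≤ C * (δ⁻¹) ^ s := mul_nonneg hC (Real.rpow_nonneg (inv_nonneg.2 hδ.le) s)
  -- Homogeneity speaks only of scales below the diameter; at larger scales one point is a net,
  -- hence the summand 1. Below it, a maximal separated set is a net, and homogeneity makes it
  -- finite.
  by_cases hdX : δ < diam X
  · obtain ⟨V, hV⟩ := zorn_subset {V : Set Plane | V ⊆ X ∧ IsSepSet δ V} (by
      intro c hc hchain
      refine ⟨⋃₀ c, ⟨sUnion_subset fun V hV => (hc hV).1, ?_⟩, fun V hV => subset_sUnion_of_mem hV⟩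
      rintro x ⟨V, hV, hxV⟩ y ⟨W, hW, hyW⟩ hxy
      rcases hchain.total hV hW with h | h
      · exact (hc hW).2 x (h hxV) y hyW hxy
      · exact (hc hV).2 x hxV y (h hyW) hxy)
    obtain ⟨hfin, hcard⟩ := hX X subset_rfl hb δ hδ hdX V hV.prop.1 hV.prop.2
    refine ⟨hfin.toFinset, by simpa using hV.prop.1, ?_, ?_⟩
    · rw [← Set.ncard_eq_toFinset_card V hfin]
      have : (δ⁻¹ * diam X) ^ s ≤ (δ⁻¹) ^ s := by
        apply Real.rpow_le_rpow (mul_nonneg (inv_nonneg.2 hδ.le) diam_nonneg) _ hs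
        exact mul_le_of_le_one_right (inv_nonneg.2 hδ.le) hd
      nlinarith [mul_le_mul_of_nonneg_left this hC]
    · intro x hx
      by_contra! hcon
      have hsep : IsSepSet δ (insert x V) := by
        rintro y (rfl | hy) y' (rfl | hy') hne
        · exact absurd rfl hne
        · exact (hcon y' (by simpa using hy')).le
        · rw [dist_comm]; exact (hcon y (by simpa using hy)).le
        · exact hV.prop.2 y hy y' hy' hne
      have hmem : x ∈ V := hV.le_of_ge (y := insert x V) ⟨insert_subset hx hV.prop.1, hsep⟩
        (subset_insert x V) (mem_insert x V)
      have := hcon x (by simpa using hmem)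
      rw [dist_self] at this
      linarith
  · rcases X.eq_empty_or_nonempty with rfl | ⟨x₀, hx₀⟩
    · exact ⟨∅, by simp, by simpa using by linarith, by simp⟩
    · refine ⟨{x₀}, by simpa using hx₀, by simpa using hpow, fun x hx => ⟨x₀, by simp, ?_⟩⟩
      exact (dist_le_diam_of_mem hb hx hx₀).trans (not_lt.1 hdX)

/-- A finite set of reals keeps a distance from a suitable translate of `κ ℤ`. -/
theorem exists_offset (V : Finset ℝ) {κ h : ℝ} (hh : 0 < h) (hκ : 2 * h * (V.card + 1) ≤ κ) :
    ∃ a : ℝ, ∀ v ∈ V, ∃ n : ℤ, a + κ * n + h ≤ v ∧ v + h ≤ a + κ * n + κ := by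
  by_contra! hcon
  have hN : (0 : ℝ) < V.card + 1 := by positivity
  have hκ0 : 0 < κ := lt_of_lt_of_le (by positivity) hκ
  -- Try the offsets `κ m / (N + 1)` for `m = 0, …, N`, where `N` is the size of `V`. If all fail,
  -- two of them fail at the same point of `V`, although they differ modulo `κ` by at least `κ / (N
  -- + 1) ≥ 2 h`.
  have hbad : ∀ m : ℕ, ∃ v ∈ V, ∃ n : ℤ, |v - κ * m / (V.card + 1) - κ * n| < h := by
    intro m
    obtain ⟨v, hv, hn⟩ := hcon (κ * m / (V.card + 1))
    refine ⟨v, hv, ?_⟩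
    set a := κ * m / (V.card + 1)
    have h1 := Int.floor_le ((v - a) / κ)
    have h2 := Int.lt_floor_add_one ((v - a) / κ)
    rw [le_div_iff₀ hκ0] at h1
    rw [div_lt_iff₀ hκ0] at h2
    by_cases h3 : a + κ * ⌊(v - a) / κ⌋ + h ≤ v
    · have := hn _ h3
      refine ⟨⌊(v - a) / κ⌋ + 1, ?_⟩
      push_cast
      rw [abs_lt]
      constructor <;> linarith
    · refine ⟨⌊(v - a) / κ⌋, ?_⟩
      rw [abs_lt]
      constructor <;> linarith
  choose f hfV n hn using hbad
  obtain ⟨m, hm, m', hm', hne, heq⟩ := Finset.exists_ne_map_eq_of_card_lt_of_maps_to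
    (s := Finset.range (V.card + 1)) (t := V) (by simp) (f := f) (fun m _ => hfV m)
  have e1 := hn m
  have e2 := hn m'
  rw [heq] at e1
  have e3 : |κ * ((m : ℝ) - m') / (V.card + 1) + κ * (n m - n m')| < 2 * h := by
    rw [abs_lt] at e1 e2 ⊢
    have : κ * ((m : ℝ) - m') / (V.card + 1) = κ * m / (V.card + 1) - κ * m' / (V.card + 1) := by
      ring
    constructor <;> linarith [e1.1, e1.2, e2.1, e2.2]
  have e4 : |((m : ℝ) - m') + (V.card + 1) * (n m - n m')| < 1 := by
    have : κ * ((m : ℝ) - m') / (V.card + 1) + κ * (n m - n m')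
        = κ / (V.card + 1) * (((m : ℝ) - m') + (V.card + 1) * (n m - n m')) := by
      field_simp
    rw [this, abs_mul, abs_of_pos (by positivity)] at e3
    have h5 : 2 * h ≤ κ / (V.card + 1) := by rw [le_div_iff₀ hN]; exact hκ
    by_contra hc
    push Not at hc
    nlinarith [mul_le_mul_of_nonneg_left hc (by positivity : 0 ≤ κ / (V.card + 1 : ℝ))]
  have e5 : |((m : ℤ) - m') + (V.card + 1) * (n m - n m')| < 1 := by exact_mod_cast e4
  rw [Int.abs_lt_one_iff] at e5
  rw [Finset.mem_range] at hm hm'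
  have hk : n m - n m' = 0 := by
    by_contra hk
    have h1 : |(n m - n m')| ≥ 1 := Int.one_le_abs hk
    have h2 : (m : ℤ) - m' = -((V.card + 1) * (n m - n m')) := by linarith
    have h3 : |(m : ℤ) - m'| = (V.card + 1) * |n m - n m'| := by
      rw [h2, abs_neg, abs_mul, abs_of_nonneg (by positivity)]
    have h4 : |(m : ℤ) - m'| < V.card + 1 := by rw [abs_lt]; omega
    nlinarith
  rw [hk] at e5
  apply hne
  omega

/-! ### Bi-Lipschitz isotopies and their concatenation -/

/-- A bi-Lipschitz isotopy of the plane that starts at the identity and fixes the complement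
of `Ω`. -/
structure IsIsotopyIn (Ω : Set Plane) (H : unitInterval → Plane ≃ₜ Plane) : Prop where
  zero : ∀ x, H 0 x = x
  fixes : ∀ t, ∀ x ∉ Ω, H t x = x
  biLip : ∀ t, ∃ L : ℝ, 1 ≤ L ∧ IsBiLipschitz L (H t)
  path : ∀ ε : ℝ, 0 < ε → ∃ δ : ℝ, 0 < δ ∧ ∀ s t : unitInterval, |(s : ℝ) - (t : ℝ)| < δ →
    (∀ x, dist (H s ((H t).symm x)) x < ε) ∧
    IsBiLipschitz (1 + ε) (fun x => H s ((H t).symm x))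

theorem IsBiLipschitz.comp {M N P : Type*} [MetricSpace M] [MetricSpace N] [MetricSpace P]
    {L K : ℝ} {f : N → P} {g : M → N} (hK : 0 < K) (hf : IsBiLipschitz K f)
    (hg : IsBiLipschitz L g) : IsBiLipschitz (K * L) (fun x => f (g x)) := by
  intro x y
  obtain ⟨h1, h2⟩ := hf (g x) (g y)
  obtain ⟨h3, h4⟩ := hg x y
  constructor
  · rw [mul_inv, mul_assoc]
    exact (mul_le_mul_of_nonneg_left h3 (inv_nonneg.2 hK.le)).trans h1
  · rw [mul_assoc]
    exact h2.trans (mul_le_mul_of_nonneg_left h4 hK.le)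

theorem IsBiLipschitz.mono {M N : Type*} [MetricSpace M] [MetricSpace N]
    {L K : ℝ} {f : M → N} (hL : 0 < L) (hf : IsBiLipschitz L f) (h : L ≤ K) :
    IsBiLipschitz K f := fun x y =>
  ⟨(mul_le_mul_of_nonneg_right (inv_anti₀ hL h) dist_nonneg).trans (hf x y).1,
    (hf x y).2.trans (mul_le_mul_of_nonneg_right h dist_nonneg)⟩

theorem isIsotopyIn_refl (Ω : Set Plane) : IsIsotopyIn Ω fun _ => Homeomorph.refl Plane where
  zero _ := rfl
  fixes _ _ _ := rfl
  biLip _ := ⟨1, le_rfl, fun x y => by simp⟩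
  path ε hε := ⟨1, one_pos, fun s t _ => ⟨fun x => by simpa using hε,
    IsBiLipschitz.mono one_pos (fun x y => by simp) (by linarith)⟩⟩

/-- The time parameter of the first half of a concatenation. -/
def firstHalf (t : unitInterval) : unitInterval := projIcc 0 1 zero_le_one (2 * (t : ℝ))

/-- The time parameter of the second half of a concatenation. -/
def secondHalf (t : unitInterval) : unitInterval := projIcc 0 1 zero_le_one (2 * (t : ℝ) - 1)

theorem abs_firstHalf_sub_le (s t : unitInterval) :
    |(firstHalf s : ℝ) - firstHalf t| ≤ 2 * |(s : ℝ) - t| := by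
  have h := abs_projIcc_sub_projIcc (a := (0 : ℝ)) (b := 1) (c := 2 * (s : ℝ)) (d := 2 * (t : ℝ))
    zero_le_one
  rwa [← mul_sub, abs_mul, abs_two] at h

theorem abs_secondHalf_sub_le (s t : unitInterval) :
    |(secondHalf s : ℝ) - secondHalf t| ≤ 2 * |(s : ℝ) - t| := by
  have h := abs_projIcc_sub_projIcc (a := (0 : ℝ)) (b := 1) (c := 2 * (s : ℝ) - 1)
    (d := 2 * (t : ℝ) - 1) zero_le_one
  rwa [sub_sub_sub_cancel_right, ← mul_sub, abs_mul, abs_two] at h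

theorem firstHalf_eq_one {t : unitInterval} (h : 1 / 2 ≤ (t : ℝ)) : firstHalf t = 1 :=
  projIcc_of_right_le _ (by linarith)

theorem secondHalf_eq_zero {t : unitInterval} (h : (t : ℝ) ≤ 1 / 2) : secondHalf t = 0 :=
  projIcc_of_le_left _ (by linarith)

/-- Running `H` and then `K` at double speed costs a factor 2 in the modulus. Since `K` starts at
the identity, times on opposite sides of `1/2` give a composition of one small increment of each. -/
theorem IsIsotopyIn.trans {Ω : Set Plane} {H K : unitInterval → Plane ≃ₜ Plane}
    (hH : IsIsotopyIn Ω H) (hK : IsIsotopyIn Ω K) :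
    IsIsotopyIn Ω fun t => (H (firstHalf t)).trans (K (secondHalf t)) where
  zero x := by
    rw [secondHalf_eq_zero (by simp)]
    have : firstHalf 0 = 0 := projIcc_of_le_left _ (by simp)
    simp [this, hH.zero, hK.zero]
  fixes t x hx := by simp [hH.fixes _ x hx, hK.fixes _ x hx]
  biLip t := by
    obtain ⟨L, hL, h⟩ := hH.biLip (firstHalf t)
    obtain ⟨L', hL', h'⟩ := hK.biLip (secondHalf t)
    exact ⟨L' * L, one_le_mul_of_one_le_of_one_le hL' hL, fun x y =>
      IsBiLipschitz.comp (f := K (secondHalf t)) (g := H (firstHalf t)) (by linarith) h' h x y⟩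
  path ε hε := by
    -- With `e ≤ 1` and `3 e ≤ ε`, both `(1 + e)² ≤ 1 + 3 e ≤ 1 + ε` and `2 e < ε` hold.
    have hε' : 0 < min (ε / 3) 1 := lt_min (by linarith) one_pos
    set e := min (ε / 3) 1
    have he3 : e ≤ ε / 3 := min_le_left _ _
    have he1 : e ≤ 1 := min_le_right _ _
    obtain ⟨δ₁, hδ₁, h₁⟩ := hH.path e hε'
    obtain ⟨δ₂, hδ₂, h₂⟩ := hK.path e hε'
    refine ⟨min δ₁ δ₂ / 2, by positivity, fun s t hst => ?_⟩
    have hH' := h₁ (firstHalf s) (firstHalf t) (by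
      have := abs_firstHalf_sub_le s t
      have := min_le_left δ₁ δ₂
      linarith)
    have hK' := h₂ (secondHalf s) (secondHalf t) (by
      have := abs_secondHalf_sub_le s t
      have := min_le_right δ₁ δ₂
      linarith)
    have hK0 : ∀ x, (K 0).symm x = x := fun x => by rw [Homeomorph.symm_apply_eq, hK.zero]
    have hsq : (1 + e) * (1 + e) ≤ 1 + ε := by nlinarith
    simp only [Homeomorph.trans_apply, Homeomorph.symm_trans_apply]
    rcases le_total (1 / 2) (t : ℝ) with ht | ht
    · rcases le_total (1 / 2) (s : ℝ) with hs | hs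
      · rw [firstHalf_eq_one ht, firstHalf_eq_one hs]
        simp only [Homeomorph.apply_symm_apply]
        exact ⟨fun x => (hK'.1 x).trans_le (by linarith), hK'.2.mono (by linarith) (by linarith)⟩
      · rw [secondHalf_eq_zero hs] at hK' ⊢
        simp only [hK.zero] at hK' ⊢
        refine ⟨fun x => ?_, (IsBiLipschitz.comp (by linarith) hH'.2 hK'.2).mono
          (by positivity) hsq⟩
        have := dist_triangle (H (firstHalf s) ((H (firstHalf t)).symm ((K (secondHalf t)).symm x)))
          ((K (secondHalf t)).symm x) x
        linarith [hH'.1 ((K (secondHalf t)).symm x), hK'.1 x]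
    · rw [secondHalf_eq_zero ht] at hK' ⊢
      simp only [hK0] at hK' ⊢
      refine ⟨fun x => ?_, (IsBiLipschitz.comp (by linarith) hK'.2 hH'.2).mono
        (by positivity) hsq⟩
      have := dist_triangle (K (secondHalf s) (H (firstHalf s) ((H (firstHalf t)).symm x)))
        (H (firstHalf s) ((H (firstHalf t)).symm x)) x
      linarith [hK'.1 (H (firstHalf s) ((H (firstHalf t)).symm x)), hH'.1 x]

/-- An isotopy that fixes the complement of `Ω` restricts to a bi-Lipschitz path in `LIP(Ω)`. -/
theorem IsIsotopyIn.exists_restrict {Ω : Set Plane} {H : unitInterval → Plane ≃ₜ Plane}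
    (hH : IsIsotopyIn Ω H) : ∃ G : unitInterval → LIP Ω, IsBiLipschitzPath G ∧
      ∀ t, ∀ p : Ω, ((G t).1 p : Plane) = H t p := by
  have hmem : ∀ t x, x ∈ Ω ↔ H t x ∈ Ω := by
    intro t x
    constructor
    · intro hx
      by_contra hc
      have := (H t).injective (hH.fixes t _ hc)
      exact hc (this.symm ▸ hx)
    · intro hx
      by_contra hc
      exact hc (hH.fixes t x hc ▸ hx)
  refine ⟨fun t => ⟨(H t).subtype (hmem t), ?_⟩, ?_, fun _ _ => rfl⟩
  · obtain ⟨L, hL, h⟩ := hH.biLip t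
    exact ⟨L, hL, fun x y => h x y⟩
  · intro ε hε
    obtain ⟨δ, hδ, h⟩ := hH.path ε hε
    exact ⟨δ, hδ, fun s t hst => ⟨fun x => (h s t hst).1 x, fun x y => (h s t hst).2 x y⟩⟩

/-! ### Shears as isotopies -/

/-- The shear `p ↦ p + t g(p) e_i` as an isotopy. -/
theorem exists_shear_isotopy {Ω : Set Plane} (g : Plane → ℝ) (i : Fin 2) {K B θ : ℝ}
    (hK : 0 ≤ K) (hθ₀ : 0 ≤ θ) (hθ₁ : θ < 1) (hLip : ∀ p q, |g p - g q| ≤ K * dist p q)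
    (hB : ∀ p, |g p| ≤ B) (hsupp : ∀ p ∉ Ω, g p = 0)
    (hslope : ∀ p q : Plane, (∀ j ≠ i, p j = q j) → q i ≤ p i → -θ * (p i - q i) ≤ g p - g q) :
    ∃ H, IsIsotopyIn Ω H ∧
      ∀ t p, H t p = p + ((t : ℝ) * g p) • EuclideanSpace.single i (1 : ℝ) := by
  set e : Plane := EuclideanSpace.single i (1 : ℝ) with he
  have hei : e i = 1 := by simp [he]
  have hej : ∀ j ≠ i, e j = 0 := fun j hj => by simp [he, hj]
  have hen : ‖e‖ = 1 := by simp [he]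
  set F : unitInterval → Plane → Plane := fun t p => p + ((t : ℝ) * g p) • e with hF
  have hFi : ∀ t p, F t p i = p i + t * g p := fun t p => by simp [hF, hei]
  have hFj : ∀ t p, ∀ j ≠ i, F t p j = p j := fun t p j hj => by simp [hF, hej j hj]
  set L : ℝ := 1 + (1 + K) / (1 - θ) with hL
  have h1θ : 0 < 1 - θ := by linarith
  have hL1 : 1 ≤ L := by
    have : 0 ≤ (1 + K) / (1 - θ) := by positivity
    linarith
  have hlow : ∀ (t : unitInterval) p q, dist p q ≤ L * dist (F t p) (F t q) := by
    intro t
    have key : ∀ p q : Plane, q i ≤ p i → dist p q ≤ L * dist (F t p) (F t q) := by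
      intro p q hpq
      -- `q'` is `q` slid along `e` to the height of `p`. The part from `p` to `q'` is seen by the
      -- transverse coordinate; on the part from `q'` to `q` the slope bound `-θ > -1` prevents
      -- collapse.
      set q' : Plane := q + (p i - q i) • e with hq'
      have hq'i : q' i = p i := by simp [hq', hei]
      have hq'j : ∀ j ≠ i, q' j = q j := fun j hj => by simp [hq', hej j hj]
      have hD : dist p q' ≤ dist (F t p) (F t q) := by
        apply dist_le_dist_of_forall_ne (i := i) hq'i.symm
        intro j hj
        rw [hFj t p j hj, hFj t q j hj]
        exact ⟨rfl, hq'j j hj⟩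
      have hqq : dist q' q = p i - q i := by
        rw [dist_eq_norm, hq', add_sub_cancel_left, norm_smul, hen, mul_one, Real.norm_eq_abs,
          abs_of_nonneg (by linarith)]
      have hs := hslope q' q hq'j (by rw [hq'i]; exact hpq)
      rw [hq'i] at hs
      have h1 := abs_sub_le_dist (F t p) (F t q) i
      rw [hFi, hFi] at h1
      have h2 := (abs_le.1 (hLip p q')).1
      have h3 := (abs_le.1 h1).2
      have t0 := t.2.1
      have t1 := t.2.2
      have hdn : 0 ≤ dist p q' := dist_nonneg
      have h4 : (t : ℝ) * (g p - g q) ≥ -(K * dist p q') - θ * (p i - q i) := by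
        have h5 : g p - g q ≥ -(K * dist p q' + θ * (p i - q i)) := by linarith
        have h6 : 0 ≤ K * dist p q' + θ * (p i - q i) := by
          have : 0 ≤ p i - q i := by linarith
          positivity
        nlinarith
      have h7 : (1 - θ) * (p i - q i) ≤ (1 + K) * dist (F t p) (F t q) := by
        nlinarith
      have h8 : p i - q i ≤ (1 + K) / (1 - θ) * dist (F t p) (F t q) := by
        rw [div_mul_eq_mul_div, le_div_iff₀ h1θ]
        linarith
      have := dist_triangle p q' q
      rw [hL, add_mul, one_mul]
      linarith
    intro p q
    rcases le_total (q i) (p i) with h | h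
    · exact key p q h
    · rw [dist_comm p, dist_comm (F t p)]
      exact key q p h
  have hupp : ∀ (t : unitInterval) p q, dist (F t p) (F t q) ≤ (1 + K) * dist p q := by
    intro t p q
    have : dist (F t p) (F t q) ≤ dist p q + dist (((t : ℝ) * g p) • e) (((t : ℝ) * g q) • e) :=
      dist_add_add_le _ _ _ _
    rw [dist_eq_norm (((t : ℝ) * g p) • e), ← sub_smul, norm_smul, hen, mul_one, ← mul_sub,
      Real.norm_eq_abs, abs_mul, abs_of_nonneg t.2.1] at this
    have h2 := hLip p q
    have : (t : ℝ) * |g p - g q| ≤ 1 * |g p - g q| :=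
      mul_le_mul_of_nonneg_right t.2.2 (abs_nonneg _)
    linarith
  have hgc : Continuous g := by
    apply LipschitzWith.continuous (K := ⟨K, hK⟩)
    exact LipschitzWith.of_dist_le_mul fun p q => hLip p q
  have hFc : ∀ t, Continuous (F t) := fun t => by
    simp only [hF]
    fun_prop
  have hinj : ∀ t, Function.Injective (F t) := by
    intro t p q h
    have := hlow t p q
    rw [h, dist_self, mul_zero] at this
    exact dist_le_zero.1 this
  -- Each line parallel to `e` is mapped to itself, and as `g` is bounded the intermediate value
  -- theorem applies on it.
  have hsurj : ∀ t, Function.Surjective (F t) := by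
    intro t p
    have hc : Continuous fun s : ℝ => s + t * g (p + s • e) := by fun_prop
    have hb : ∀ s : ℝ, |(t : ℝ) * g (p + s • e)| ≤ B := by
      intro s
      rw [abs_mul, abs_of_nonneg t.2.1]
      have := mul_le_mul_of_nonneg_right t.2.2 (abs_nonneg (g (p + s • e)))
      linarith [hB (p + s • e)]
    obtain ⟨s, hs⟩ := hc.surjective
      (Filter.tendsto_atTop_mono (fun s => by simp only [id_eq]; linarith [(abs_le.1 (hb s)).1])
        (Filter.tendsto_atTop_add_const_right _ (-B) Filter.tendsto_id))
      (Filter.tendsto_atBot_mono (fun s => by simp only [id_eq]; linarith [(abs_le.1 (hb s)).2])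
        (Filter.tendsto_atBot_add_const_right _ B Filter.tendsto_id)) 0
    refine ⟨p + s • e, ?_⟩
    simp only [hF] at hs ⊢
    rw [add_assoc, ← add_smul, hs, zero_smul, add_zero]
  set E : unitInterval → Plane ≃ Plane := fun t => Equiv.ofBijective (F t) ⟨hinj t, hsurj t⟩ with hE
  have hEs : ∀ t x, F t ((E t).symm x) = x := fun t x => (E t).apply_symm_apply x
  have hinvLip : ∀ t x y, dist ((E t).symm x) ((E t).symm y) ≤ L * dist x y := by
    intro t x y
    have := hlow t ((E t).symm x) ((E t).symm y)
    rwa [hEs, hEs] at this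
  set H : unitInterval → Plane ≃ₜ Plane := fun t =>
    { E t with
      continuous_toFun := hFc t
      continuous_invFun := by
        apply LipschitzWith.continuous (K := ⟨L, by linarith⟩)
        exact LipschitzWith.of_dist_le_mul fun p q => hinvLip t p q } with hH
  have hHF : ∀ t p, H t p = F t p := fun _ _ => rfl
  have hHE : ∀ t p, (H t).symm p = (E t).symm p := fun _ _ => rfl
  refine ⟨H, ⟨?_, ?_, ?_, ?_⟩, fun t p => rfl⟩
  · intro x
    rw [hHF]
    simp [hF]
  · intro t x hx
    rw [hHF]
    simp [hF, hsupp x hx]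
  · intro t
    refine ⟨L + K, by linarith, fun p q => ⟨?_, ?_⟩⟩
    · rw [hHF, hHF, inv_mul_le_iff₀ (by linarith)]
      refine (hlow t p q).trans (mul_le_mul_of_nonneg_right (by linarith) dist_nonneg)
    · rw [hHF, hHF]
      exact (hupp t p q).trans (mul_le_mul_of_nonneg_right (by linarith) dist_nonneg)
  · intro ε hε
    have hB0 : 0 ≤ B := (abs_nonneg _).trans (hB 0)
    set M : ℝ := B + K * L + 1 with hM
    have hKL : 0 ≤ K * L := mul_nonneg hK (by linarith)
    have hM0 : 0 < M := by linarith
    -- The increment is the identity plus a map with Lipschitz constant `|s - t| K L`. Keeping this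
    -- at most `ε / (1 + ε)` gives exactly the lower bound `(1 + ε)⁻¹`.
    refine ⟨ε / (1 + ε) / M, by positivity, fun s t hst => ?_⟩
    rw [lt_div_iff₀ hM0] at hst
    have hτ1 : ε / (1 + ε) < ε := by
      rw [div_lt_iff₀ (by linarith)]
      nlinarith
    have hτ2 : (1 + ε)⁻¹ = 1 - ε / (1 + ε) := by field_simp; ring
    have hst0 := abs_nonneg ((s : ℝ) - t)
    have hform : ∀ x, H s ((H t).symm x) = x + (((s : ℝ) - t) * g ((E t).symm x)) • e := by
      intro x
      rw [hHE, hHF]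
      conv_rhs => rw [← hEs t x]
      simp only [hF]
      rw [add_assoc, ← add_smul]
      congr 2
      conv_rhs => rw [show (E t).symm ((E t).symm x + ((t : ℝ) * g ((E t).symm x)) • e)
        = (E t).symm x by rw [Equiv.symm_apply_eq]; rfl]
      ring
    refine ⟨fun x => ?_, fun x y => ?_⟩
    · rw [hform, dist_eq_norm, add_sub_cancel_left, norm_smul, hen, mul_one, Real.norm_eq_abs,
        abs_mul]
      have := mul_le_mul_of_nonneg_left (hB ((E t).symm x)) hst0
      nlinarith
    · have hdiff : dist ((((s : ℝ) - t) * g ((E t).symm x)) • e)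
          ((((s : ℝ) - t) * g ((E t).symm y)) • e) ≤ ε / (1 + ε) * dist x y := by
        rw [dist_eq_norm, ← sub_smul, norm_smul, hen, mul_one, ← mul_sub, Real.norm_eq_abs, abs_mul]
        have h1 := hLip ((E t).symm x) ((E t).symm y)
        have h2 := mul_le_mul_of_nonneg_left (hinvLip t x y) hK
        have h3 := mul_le_mul_of_nonneg_left (h1.trans h2) hst0
        have h4 : |(s : ℝ) - t| * (K * L) ≤ ε / (1 + ε) := by nlinarith
        have h5 := mul_le_mul_of_nonneg_right h4 (dist_nonneg (x := x) (y := y))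
        linarith
      have hu := dist_add_add_le x ((((s : ℝ) - t) * g ((E t).symm x)) • e) y
        ((((s : ℝ) - t) * g ((E t).symm y)) • e)
      have hl : dist x y ≤ dist (x + (((s : ℝ) - t) * g ((E t).symm x)) • e)
          (y + (((s : ℝ) - t) * g ((E t).symm y)) • e) +
          dist ((((s : ℝ) - t) * g ((E t).symm x)) • e)
          ((((s : ℝ) - t) * g ((E t).symm y)) • e) := by
        set a := (((s : ℝ) - t) * g ((E t).symm x)) • e
        set b := (((s : ℝ) - t) * g ((E t).symm y)) • e
        rw [dist_eq_norm, dist_eq_norm, dist_eq_norm,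
          show x - y = x + a - (y + b) - (a - b) by abel]
        exact norm_sub_le _ _
      simp only [hform]
      have hd := dist_nonneg (x := x) (y := y)
      constructor
      · rw [hτ2, sub_mul, one_mul]
        linarith
      · have := mul_le_mul_of_nonneg_right hτ1.le hd
        linarith

/-! ### The accordion function and the cutoff -/

open MeasureTheory

/-- The accordion function: a Lipschitz function vanishing off `[0, 2κ]`, constant on the given
intervals, such that `x ↦ x + u x` is an increasing map carrying `[w, 2κ - w]` into its right
half. -/
theorem exists_push_right {ι : Type*} [Fintype ι] (q : ι → ℝ) {κ w d : ℝ} (hκ : 0 < κ) (hw : 0 < w)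
    (hd : 0 ≤ d) (hN : Fintype.card ι * d + 2 * w < κ) :
    ∃ (u : ℝ → ℝ) (K B θ : ℝ), 0 ≤ K ∧ 0 ≤ θ ∧ θ < 1 ∧ (∀ x y, |u x - u y| ≤ K * |x - y|) ∧
      (∀ x, |u x| ≤ B) ∧ (∀ x, x ≤ 0 → u x = 0) ∧ (∀ x, 2 * κ ≤ x → u x = 0) ∧
      (∀ x y, y ≤ x → -θ * (x - y) ≤ u x - u y) ∧
      (∀ k, w ≤ q k → q k + d ≤ 2 * κ - w → ∀ x ∈ Icc (q k) (q k + d), u x = u (q k)) ∧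
      ∀ x, w ≤ x → x ≤ 2 * κ - w → κ + w ≤ x + u x ∧ x + u x ≤ 2 * κ - w := by
  set E : Set ℝ := ⋃ k, Icc (q k) (q k + d) with hE
  have hEm : MeasurableSet E := MeasurableSet.iUnion fun _ => measurableSet_Icc
  have hEvol : volume.real E ≤ Fintype.card ι * d := by
    refine (measureReal_iUnion_fintype_le _).trans ?_
    simp [Real.volume_real_Icc, hd]
  -- `h x` measures the free space between `w` and `x`: it is monotone, 1-Lipschitz, and constant
  -- across each interval. Using the union `E` makes overlaps harmless.
  set h : ℝ → ℝ := fun x => volume.real (Ioc w x \ E) with hh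
  have hfin : ∀ a b : ℝ, volume (Ioc a b \ E) ≠ ⊤ := fun a b =>
    measure_ne_top_of_subset sdiff_subset (by simp)
  have hfin' : ∀ a b : ℝ, volume (Ioc a b) ≠ ⊤ := fun a b => by simp
  have hmono : Monotone h := fun x y hxy =>
    measureReal_mono (sdiff_subset_sdiff_left (Ioc_subset_Ioc_right hxy)) (hfin _ _)
  have hgrow : ∀ x y, x ≤ y → h y ≤ h x + (y - x) := by
    intro x y hxy
    have h1 : Ioc w y \ E ⊆ (Ioc w x \ E) ∪ Ioc x y := by
      rintro z ⟨⟨hz1, hz2⟩, hzE⟩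
      by_cases hz : z ≤ x
      · exact Or.inl ⟨⟨hz1, hz⟩, hzE⟩
      · exact Or.inr ⟨not_le.1 hz, hz2⟩
    have h2 := (measureReal_mono (μ := volume) h1
      (measure_union_ne_top (hfin _ _) (hfin' _ _))).trans (measureReal_union_le _ _)
    rwa [Real.volume_real_Ioc_of_le hxy] at h2
  have hw0 : ∀ x, x ≤ w → h x = 0 := fun x hx => by simp [hh, Ioc_eq_empty (not_lt.2 hx)]
  have hnn : ∀ x, 0 ≤ h x := fun x => measureReal_nonneg
  set b := 2 * κ - w with hb
  have hwb : w ≤ b := by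
    have : 0 ≤ Fintype.card ι * d := by positivity
    linarith
  -- The free space exceeds the required displacement `κ`; this gives `θ < 1`.
  have hH : κ < h b := by
    have h1 : volume.real (Ioc w b) ≤ h b + volume.real E := by
      have : Ioc w b ⊆ (Ioc w b \ E) ∪ E := by rw [sdiff_union_self]; exact subset_union_left
      refine (measureReal_mono this (measure_union_ne_top (hfin _ _) ?_)).trans
        (measureReal_union_le _ _)
      exact ((measure_iUnion_fintype_le _ _).trans_lt
        (ENNReal.sum_lt_top.2 fun k _ => by simp)).ne
    rw [Real.volume_real_Ioc_of_le hwb] at h1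
    linarith
  have hb0 : 0 < h b := hκ.trans hH
  set θ := κ / h b with hθ
  have hθ0 : 0 ≤ θ := by positivity
  have hθ1 : θ < 1 := by rw [hθ, div_lt_one hb0]; exact hH
  have hθb : θ * h b = κ := div_mul_cancel₀ _ hb0.ne'
  -- On `[w, b]` only `κ - θ h` is active, falling from `κ` to 0, so `w` goes to `κ + w` and `b`
  -- stays. The ramp `κ x / w` starts the function at 0, and the maximum cuts it off beyond `b`.
  set u : ℝ → ℝ := fun x => max 0 (min (κ * x / w) (κ - θ * h x)) with hu
  have hmid : ∀ x, w ≤ x → x ≤ b → u x = κ - θ * h x := by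
    intro x hx1 hx2
    have h1 : κ ≤ κ * x / w := by rw [le_div_iff₀ hw]; nlinarith
    have h2 : θ * h x ≤ θ * h b := mul_le_mul_of_nonneg_left (hmono hx2) hθ0
    have h3 : 0 ≤ θ * h x := mul_nonneg hθ0 (hnn x)
    simp only [hu]
    rw [min_eq_right (by linarith), max_eq_right (by linarith)]
  have humono : Monotone fun x => u x + θ * x := by
    have e : (fun x => u x + θ * x)
        = fun x => max (θ * x) (min (κ * x / w + θ * x) (κ - θ * h x + θ * x)) := by
      ext x
      simp only [hu]
      rw [max_add, min_add, zero_add]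
    rw [e]
    intro x y hxy
    have h1 : θ * x ≤ θ * y := mul_le_mul_of_nonneg_left hxy hθ0
    have h2 : κ * x / w ≤ κ * y / w := by gcongr
    have h3 := mul_le_mul_of_nonneg_left (hgrow x y hxy) hθ0
    exact max_le_max h1 (min_le_min (by linarith) (by linarith))
  have hslope : ∀ x y, y ≤ x → u x - u y ≤ κ / w * (x - y) := by
    intro x y hxy
    have h1 : 0 ≤ κ / w * (x - y) := mul_nonneg (by positivity) (by linarith)
    have h2 : κ * x / w = κ * y / w + κ / w * (x - y) := by ring
    have h3 := mul_le_mul_of_nonneg_left (hmono hxy) hθ0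
    have : u x ≤ u y + κ / w * (x - y) := by
      simp only [hu]
      refine max_le (add_nonneg (le_max_left _ _) h1) ?_
      refine le_trans ?_ (add_le_add_left (le_max_right _ _) _)
      rw [min_add]
      exact min_le_min h2.le (by linarith)
    linarith
  refine ⟨u, max (κ / w) θ, κ, θ, le_max_of_le_right hθ0, hθ0, hθ1, ?_, ?_, ?_, ?_, ?_, ?_, ?_⟩
  · have key : ∀ x y, y ≤ x → |u x - u y| ≤ max (κ / w) θ * |x - y| := by
      intro x y hxy
      rw [abs_of_nonneg (by linarith : 0 ≤ x - y), abs_le]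
      have h1 := humono hxy
      have h2 := hslope x y hxy
      have h3 : κ / w * (x - y) ≤ max (κ / w) θ * (x - y) :=
        mul_le_mul_of_nonneg_right (le_max_left _ _) (by linarith)
      have h4 : θ * (x - y) ≤ max (κ / w) θ * (x - y) :=
        mul_le_mul_of_nonneg_right (le_max_right _ _) (by linarith)
      simp only at h1
      constructor <;> linarith
    intro x y
    rcases le_total y x with hxy | hxy
    · exact key x y hxy
    · rw [abs_sub_comm, abs_sub_comm x]
      exact key y x hxy
  · intro x
    rw [abs_of_nonneg (le_max_left _ _)]
    refine max_le hκ.le ((min_le_right _ _).trans ?_)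
    have := mul_nonneg hθ0 (hnn x)
    linarith
  · intro x hx
    refine max_eq_left ((min_le_left _ _).trans ?_)
    exact div_nonpos_of_nonpos_of_nonneg (mul_nonpos_of_nonneg_of_nonpos hκ.le hx) hw.le
  · intro x hx
    refine max_eq_left ((min_le_right _ _).trans ?_)
    have := mul_le_mul_of_nonneg_left (hmono (show b ≤ x by linarith)) hθ0
    linarith
  · intro x y hxy
    have := humono hxy
    simp only at this
    linarith
  · intro k hk1 hk2 x hx
    rw [hmid x (hk1.trans hx.1) (hx.2.trans hk2), hmid _ hk1 (by linarith)]
    congr 2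
    simp only [hh]
    congr 1
    ext z
    constructor
    · rintro ⟨⟨h1, h2⟩, h3⟩
      refine ⟨⟨h1, ?_⟩, h3⟩
      by_contra hc
      exact h3 (mem_iUnion.2 ⟨k, (not_le.1 hc).le, h2.trans hx.2⟩)
    · rintro ⟨⟨h1, h2⟩, h3⟩
      exact ⟨⟨h1, h2.trans hx.1⟩, h3⟩
  · intro x hx1 hx2
    rw [hmid x hx1 hx2]
    have h1 := hgrow w x hx1
    rw [hw0 w le_rfl] at h1
    have h2 := hgrow x b hx2
    have h3 := hnn x
    have h4 := hmono hx2
    constructor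
    · nlinarith
    · have : θ * h b ≤ θ * (h x + (b - x)) := mul_le_mul_of_nonneg_left h2 hθ0
      nlinarith

/-- The accordion function of `exists_push_right` on an interval `[b, b + 2κ]`, pushing to the
right half if `r` holds and to the left half otherwise. -/
theorem exists_push {ι : Type*} [Fintype ι] (q : ι → ℝ) {κ w d : ℝ} (b : ℝ) (hκ : 0 < κ)
    (hw : 0 < w) (hd : 0 ≤ d) (hN : Fintype.card ι * d + 2 * w < κ) (b' : ℝ)
    (hb' : b' = b ∨ b' = b + κ) :
    ∃ (u : ℝ → ℝ) (K B θ : ℝ), 0 ≤ K ∧ 0 ≤ θ ∧ θ < 1 ∧ (∀ x y, |u x - u y| ≤ K * |x - y|) ∧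
      (∀ x, |u x| ≤ B) ∧ (∀ x, x ≤ b → u x = 0) ∧ (∀ x, b + 2 * κ ≤ x → u x = 0) ∧
      (∀ x y, y ≤ x → -θ * (x - y) ≤ u x - u y) ∧
      (∀ k, b + w ≤ q k → q k + d ≤ b + 2 * κ - w → ∀ x ∈ Icc (q k) (q k + d), u x = u (q k)) ∧
      ∀ x, b + w ≤ x → x ≤ b + 2 * κ - w → b' + w ≤ x + u x ∧ x + u x ≤ b' + κ - w := by
  -- A push into the left half is the reflection of a push to the right in the midpoint `b + κ`.
  rcases hb' with rfl | rfl
  · obtain ⟨u, K, B, θ, h1, h2, h3, h4, h5, h6, h7, h8, h9, h10⟩ :=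
      exists_push_right (fun k => b' + 2 * κ - (q k + d)) hκ hw hd hN
    refine ⟨fun x => -u (b' + 2 * κ - x), K, B, θ, h1, h2, h3, fun x y => ?_, fun x => ?_,
      fun x hx => ?_, fun x hx => ?_, fun x y hxy => ?_, fun k hk1 hk2 x hx => ?_,
      fun x hx1 hx2 => ?_⟩
    · have := h4 (b' + 2 * κ - y) (b' + 2 * κ - x)
      rw [sub_sub_sub_cancel_left] at this
      rwa [neg_sub_neg]
    · rw [abs_neg]; exact h5 _
    · simp only; rw [h7 _ (by linarith), neg_zero]
    · simp only; rw [h6 _ (by linarith), neg_zero]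
    · have := h8 (b' + 2 * κ - y) (b' + 2 * κ - x) (by linarith)
      rw [sub_sub_sub_cancel_left] at this
      simp only
      linarith
    · have e : ∀ y ∈ Icc (q k) (q k + d), u (b' + 2 * κ - y) = u (b' + 2 * κ - (q k + d)) :=
        fun y hy => h9 k (by linarith) (by linarith) _ ⟨by linarith [hy.2], by linarith [hy.1]⟩
      simp only
      rw [e x hx, e (q k) ⟨le_rfl, by linarith⟩]
    · have := h10 (b' + 2 * κ - x) (by linarith) (by linarith)
      constructor <;> linarith [this.1, this.2]
  · obtain ⟨u, K, B, θ, h1, h2, h3, h4, h5, h6, h7, h8, h9, h10⟩ :=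
      exists_push_right (fun k => q k - b) hκ hw hd hN
    refine ⟨fun x => u (x - b), K, B, θ, h1, h2, h3, fun x y => ?_, fun x => h5 _,
      fun x hx => h6 _ (by linarith), fun x hx => h7 _ (by linarith), fun x y hxy => ?_,
      fun k hk1 hk2 x hx => ?_, fun x hx1 hx2 => ?_⟩
    · have := h4 (x - b) (y - b)
      rwa [sub_sub_sub_cancel_right] at this
    · have := h8 (x - b) (y - b) (by linarith)
      rwa [sub_sub_sub_cancel_right] at this
    · exact h9 k (by linarith) (by linarith) _ ⟨by linarith [hx.1], by linarith [hx.2]⟩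
    · have := h10 (x - b) (by linarith) (by linarith)
      constructor <;> linarith [this.1, this.2]

/-- A Lipschitz plateau function on `[b, b + κ]`. -/
theorem exists_plateau {w : ℝ} (b κ : ℝ) (hw : 0 < w) :
    ∃ ψ : ℝ → ℝ, (∀ x, 0 ≤ ψ x) ∧ (∀ x, ψ x ≤ 1) ∧ (∀ x y, |ψ x - ψ y| ≤ w⁻¹ * |x - y|) ∧
      (∀ x, x ≤ b → ψ x = 0) ∧ (∀ x, b + κ ≤ x → ψ x = 0) ∧
      ∀ x, b + w ≤ x → x ≤ b + κ - w → ψ x = 1 := by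
  have hwi : 0 < w⁻¹ := inv_pos.2 hw
  have hww : w⁻¹ * w = 1 := inv_mul_cancel₀ hw.ne'
  refine ⟨fun x => max 0 (min 1 (min (w⁻¹ * (x - b)) (w⁻¹ * (b + κ - x)))), fun x => le_max_left _ _,
    fun x => max_le zero_le_one (min_le_left _ _), fun x y => ?_, fun x hx => ?_, fun x hx => ?_,
    fun x hx1 hx2 => ?_⟩
  · beta_reduce
    rw [max_comm 0, max_comm 0]
    refine (abs_max_sub_max_le_abs _ _ 0).trans ?_
    rw [min_comm 1, min_comm 1]
    refine (abs_min_sub_min_le_max _ _ _ _).trans (max_le ?_ ?_)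
    · refine (abs_min_sub_min_le_max _ _ _ _).trans (max_le ?_ ?_)
      · rw [← mul_sub, abs_mul, abs_of_pos hwi, sub_sub_sub_cancel_right]
      · rw [← mul_sub, abs_mul, abs_of_pos hwi, sub_sub_sub_cancel_left, abs_sub_comm]
    · rw [sub_self, abs_zero]; positivity
  · exact max_eq_left ((min_le_right _ _).trans ((min_le_left _ _).trans
      (mul_nonpos_of_nonneg_of_nonpos hwi.le (by linarith))))
  · exact max_eq_left ((min_le_right _ _).trans ((min_le_right _ _).trans
      (mul_nonpos_of_nonneg_of_nonpos hwi.le (by linarith))))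
  · have h1 : 1 ≤ w⁻¹ * (x - b) := by
      rw [← hww]; exact mul_le_mul_of_nonneg_left (by linarith) hwi.le
    have h2 : 1 ≤ w⁻¹ * (b + κ - x) := by
      rw [← hww]; exact mul_le_mul_of_nonneg_left (by linarith) hwi.le
    simp only
    rw [min_eq_left (le_min h1 h2), max_eq_right zero_le_one]

/-! ### Moving boxes between cells -/

/-- The closed square of side `d` with lower left corner `p`. -/
def cornerBox (d : ℝ) (p : Fin 2 → ℝ) : Set Plane := {x | ∀ i, p i ≤ x i ∧ x i ≤ p i + d}

/-- The closed cell with index `n` of the grid of mesh `κ` with offset `a`. -/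
def gridCell (a : Fin 2 → ℝ) (κ : ℝ) (n : Fin 2 → ℤ) : Set Plane :=
  cornerBox κ fun i => a i + κ * n i

/-- The box of side `d` at `p` lies in the cell `n`, at distance `w` from its boundary. -/
def BoxInCell (a : Fin 2 → ℝ) (κ w d : ℝ) (p : Fin 2 → ℝ) (n : Fin 2 → ℤ) : Prop :=
  ∀ i, a i + κ * n i + w ≤ p i ∧ p i + d ≤ a i + κ * n i + κ - w

/-- Some isotopy in `Ω` translates each box of side `d` at `p k` to the one at `q k`. -/
def BoxMove {ι : Type*} (Ω : Set Plane) (d : ℝ) (p q : ι → Fin 2 → ℝ) : Prop :=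
  ∃ H, IsIsotopyIn Ω H ∧ (∀ t k, ∃ v : Plane, ∀ x ∈ cornerBox d (p k), H t x = x + v) ∧
    ∀ k, ∀ x ∈ cornerBox d (p k), H 1 x ∈ cornerBox d (q k)

/-- Two cells contained in `Ω` that share an edge. -/
def CellStep (Ω : Set Plane) (a : Fin 2 → ℝ) (κ : ℝ) (A B : Fin 2 → ℤ) : Prop :=
  gridCell a κ A ⊆ Ω ∧ gridCell a κ B ⊆ Ω ∧
    ∃ i, (∀ j ≠ i, A j = B j) ∧ (B i = A i + 1 ∨ A i = B i + 1)

theorem boxMove_refl {ι : Type*} (Ω : Set Plane) (d : ℝ) (p : ι → Fin 2 → ℝ) : BoxMove Ω d p p :=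
  ⟨_, isIsotopyIn_refl Ω, fun _ _ => ⟨0, fun x _ => (add_zero x).symm⟩, fun _ _ hx => hx⟩

/-- The second isotopy acts on a box only after the first has put it inside its target box, so
displacements add. -/
theorem BoxMove.trans {ι : Type*} {Ω : Set Plane} {d : ℝ} {p q r : ι → Fin 2 → ℝ}
    (h₁ : BoxMove Ω d p q) (h₂ : BoxMove Ω d q r) : BoxMove Ω d p r := by
  obtain ⟨H, hH, hHt, hH1⟩ := h₁
  obtain ⟨K, hK, hKt, hK1⟩ := h₂
  refine ⟨_, hH.trans hK, fun t k => ?_, fun k x hx => ?_⟩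
  · obtain ⟨v, hv⟩ := hHt (firstHalf t) k
    rcases le_total (1 / 2) (t : ℝ) with ht | ht
    · obtain ⟨v', hv'⟩ := hKt (secondHalf t) k
      refine ⟨v + v', fun x hx => ?_⟩
      have h1 := hH1 k x hx
      rw [← firstHalf_eq_one ht] at h1
      rw [Homeomorph.trans_apply, hv' _ h1, hv x hx, add_assoc]
    · refine ⟨v, fun x hx => ?_⟩
      rw [Homeomorph.trans_apply, secondHalf_eq_zero ht, hK.zero, hv x hx]
  · rw [Homeomorph.trans_apply, firstHalf_eq_one (by norm_num)]
    have : secondHalf 1 = 1 := projIcc_of_right_le _ (by norm_num)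
    rw [this]
    exact hK1 k _ (hH1 k x hx)

/-- All boxes in a cell can be moved to an adjacent cell, within the union of the two. -/
theorem exists_merge {ι : Type*} [Fintype ι] {Ω : Set Plane} {a : Fin 2 → ℝ} {κ w d : ℝ}
    (hκ : 0 < κ) (hw : 0 < w) (hd : 0 ≤ d) (hN : Fintype.card ι * d + 2 * w < κ)
    {A B : Fin 2 → ℤ} (hAB : CellStep Ω a κ A B) (p : ι → Fin 2 → ℝ) (n : ι → Fin 2 → ℤ)
    (hpn : ∀ k, BoxInCell a κ w d (p k) (n k)) :
    ∃ q, BoxMove Ω d p q ∧ ∀ k, BoxInCell a κ w d (q k) (if n k = A then B else n k) := by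
  obtain ⟨hA, hB, i, hoff, hdir⟩ := hAB
  obtain ⟨j, hji, hij⟩ : ∃ j, j ≠ i ∧ ∀ l : Fin 2, l ≠ i → l = j := by
    fin_cases i
    · exact ⟨1, by simp, by decide⟩
    · exact ⟨0, by simp, by decide⟩
  have hint : ∀ m m' : ℤ, m < m' → κ * (m : ℝ) + κ ≤ κ * m' := by
    intro m m' h
    have : (m : ℝ) + 1 ≤ m' := by exact_mod_cast h
    nlinarith
  have hjAB := hoff j hji
  set m : ℤ := min (A i) (B i) with hm
  set b : ℝ := a i + κ * m with hb
  have hmem : ∀ l : ℤ, l = m ∨ l = m + 1 ↔ l = A i ∨ l = B i := by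
    intro l; omega
  have hb' : a i + κ * (B i : ℝ) = b ∨ a i + κ * (B i : ℝ) = b + κ := by
    rcases (hmem (B i)).2 (Or.inr rfl) with h | h
    · left; rw [h]
    · right; rw [h, hb]; push_cast; ring
  obtain ⟨u, K, M, θ, hK, hθ0, hθ1, huL, huM, hu0, hu1, hus, huc, hur⟩ :=
    exists_push (fun k => p k i) b hκ hw hd hN _ hb'
  obtain ⟨ψ, hψ0, hψ1, hψL, hψ2, hψ3, hψ4⟩ := exists_plateau (a j + κ * A j) κ hw
  have hM0 : 0 ≤ M := (abs_nonneg _).trans (huM 0)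
  have hψa : ∀ y, |ψ y| ≤ 1 := fun y => by rw [abs_of_nonneg (hψ0 y)]; exact hψ1 y
  have hwi : 0 ≤ w⁻¹ := (inv_pos.2 hw).le
  obtain ⟨H, hH, hHf⟩ := exists_shear_isotopy (Ω := Ω) (fun x => ψ (x j) * u (x i)) i
    (K := K + M * w⁻¹) (B := M) (by positivity) hθ0 hθ1
    (by
      intro x y
      have e : ψ (x j) * u (x i) - ψ (y j) * u (y i)
        = ψ (x j) * (u (x i) - u (y i)) + (ψ (x j) - ψ (y j)) * u (y i) := by ring
      rw [e]
      refine (abs_add_le _ _).trans ?_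
      rw [abs_mul, abs_mul]
      have h1 : |ψ (x j)| * |u (x i) - u (y i)| ≤ 1 * (K * dist x y) :=
        mul_le_mul (hψa _) ((huL _ _).trans
          (mul_le_mul_of_nonneg_left (abs_sub_le_dist x y i) hK)) (abs_nonneg _) zero_le_one
      have h2 : |ψ (x j) - ψ (y j)| * |u (y i)| ≤ (w⁻¹ * dist x y) * M :=
        mul_le_mul ((hψL _ _).trans (mul_le_mul_of_nonneg_left (abs_sub_le_dist x y j) hwi))
          (huM _) (abs_nonneg _) (mul_nonneg hwi dist_nonneg)
      linarith)
    (by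
      intro x
      rw [abs_mul]
      have := mul_le_mul (hψa (x j)) (huM (x i)) (abs_nonneg _) zero_le_one
      linarith)
    (by
      intro x hx
      by_contra hne
      have hψx := left_ne_zero_of_mul hne
      have hux := right_ne_zero_of_mul hne
      have h1 : a j + κ * A j < x j := not_le.1 fun h => hψx (hψ2 _ h)
      have h2 : x j < a j + κ * A j + κ := not_le.1 fun h => hψx (hψ3 _ h)
      have h3 : b < x i := not_le.1 fun h => hux (hu0 _ h)
      have h4 : x i < b + 2 * κ := not_le.1 fun h => hux (hu1 _ h)
      have key : ∀ l : ℤ, (l = A i ∨ l = B i) → a i + κ * l ≤ x i → x i ≤ a i + κ * l + κ →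
          x ∈ Ω := by
        rintro l (rfl | rfl) h5 h6
        · refine hA fun r => ?_
          by_cases hr : r = i
          · subst hr; exact ⟨h5, h6⟩
          · rw [hij r hr]; exact ⟨h1.le, h2.le⟩
        · refine hB fun r => ?_
          by_cases hr : r = i
          · subst hr; exact ⟨h5, h6⟩
          · rw [hij r hr]; beta_reduce; rw [← hjAB]; exact ⟨h1.le, h2.le⟩
      rcases le_total (x i) (b + κ) with h5 | h5
      · exact hx (key m ((hmem m).1 (Or.inl rfl)) h3.le h5)
      · refine hx (key (m + 1) ((hmem _).1 (Or.inr rfl)) ?_ ?_)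
        · push_cast; linarith
        · push_cast; linarith)
    (by
      intro x y hxy hle
      rw [hxy j hji, ← mul_sub]
      have h1 := hus _ _ hle
      have h2 : 0 ≤ θ * (x i - y i) := mul_nonneg hθ0 (by linarith)
      have h3 := hψ0 (y j)
      have h4 := hψ1 (y j)
      nlinarith)
  -- Boxes already in `B` are displaced too, but stay in the target half. On all boxes of the two
  -- cells the cutoff is 1, by the margin `w`.
  have hin : ∀ k, n k = A ∨ n k = B → (∀ x ∈ cornerBox d (p k),
      ψ (x j) * u (x i) = u (p k i)) ∧ b + w ≤ p k i ∧ p k i + d ≤ b + 2 * κ - w := by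
    intro k hk
    have hi : n k i = m ∨ n k i = m + 1 := (hmem _).2 (by rcases hk with h | h <;> simp [h])
    have hj : n k j = A j := by rcases hk with h | h <;> simp [h, hjAB]
    have h1 := hpn k i
    have h2 := hpn k j
    rw [hj] at h2
    have h3 : b + w ≤ p k i ∧ p k i + d ≤ b + 2 * κ - w := by
      rcases hi with h | h <;> rw [h] at h1
      · constructor <;> linarith
      · push_cast at h1
        constructor <;> linarith
    refine ⟨fun x hx => ?_, h3⟩
    rw [hψ4 _ (by linarith [(hx j).1]) (by linarith [(hx j).2]), one_mul]
    exact huc k h3.1 h3.2 _ (hx i)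
  have hout : ∀ k, ¬ (n k = A ∨ n k = B) → ∀ x ∈ cornerBox d (p k),
      ψ (x j) * u (x i) = 0 := by
    intro k hk x hx
    have h1 := hpn k i
    have h2 := hpn k j
    have h3 := hx i
    have h4 := hx j
    rcases lt_trichotomy (n k j) (A j) with h | h | h
    · rw [hψ2 _ (by linarith [hint _ _ h]), zero_mul]
    · have hi : ¬ (n k i = m ∨ n k i = m + 1) := by
        rw [hmem]
        intro hc
        apply hk
        rcases hc with hc | hc
        · left
          ext r
          by_cases hr : r = i
          · rw [hr, hc]
          · rw [hij r hr, h]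
        · right
          ext r
          by_cases hr : r = i
          · rw [hr, hc]
          · rw [hij r hr, h, hjAB]
      rcases lt_or_ge (n k i) m with h5 | h5
      · rw [hu0 _ (by linarith [hint _ _ h5]), mul_zero]
      · have h6 := hint (m + 1) (n k i) (by omega)
        push_cast at h6
        rw [hu1 _ (by linarith), mul_zero]
    · rw [hψ3 _ (by linarith [hint _ _ h]), zero_mul]
  classical
  refine ⟨fun k => if n k = A ∨ n k = B then Function.update (p k) i (p k i + u (p k i)) else p k,
    ⟨H, hH, fun t k => ?_, fun k x hx => ?_⟩, fun k => ?_⟩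
  · by_cases hk : n k = A ∨ n k = B
    · exact ⟨_, fun x hx => by rw [hHf, (hin k hk).1 x hx]⟩
    · exact ⟨0, fun x hx => by rw [hHf, hout k hk x hx, mul_zero, zero_smul]⟩
  · rw [hHf]
    beta_reduce
    by_cases hk : n k = A ∨ n k = B
    · rw [if_pos hk, (hin k hk).1 x hx]
      intro r
      have := hx r
      by_cases hr : r = i
      · subst hr
        simp
        constructor <;> linarith
      · simpa [hr] using this
    · rw [if_neg hk, hout k hk x hx, mul_zero, zero_smul, add_zero]
      exact hx
  · by_cases hk : n k = A ∨ n k = B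
    · have hB' : (if n k = A then B else n k) = B := by
        by_cases h : n k = A
        · rw [if_pos h]
        · rw [if_neg h]; exact hk.resolve_left h
      rw [hB']
      beta_reduce
      rw [if_pos hk]
      obtain ⟨h0, h1, h2⟩ := hin k hk
      intro r
      by_cases hr : r = i
      · subst hr
        have e1 := hur (p k r) h1 (by linarith)
        have e2 := hur (p k r + d) (by linarith) h2
        rw [huc k h1 h2 (p k r + d) ⟨by linarith, le_rfl⟩] at e2
        simp only [Function.update_self]
        constructor <;> linarith [e1.1, e2.2]
      · have e := hpn k r
        have : n k r = B r := by
          rcases hk with h | h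
          · rw [h]; exact hoff r hr
          · rw [h]
        rw [this] at e
        simpa [hr] using e
    · beta_reduce
      rw [if_neg hk, if_neg fun h => hk (Or.inl h)]
      exact hpn k

/-- All boxes of a cell can be moved along a chain of cells to its end. -/
theorem exists_gather_cell {ι : Type*} [Fintype ι] {Ω : Set Plane} {a : Fin 2 → ℝ} {κ w d : ℝ}
    (hκ : 0 < κ) (hw : 0 < w) (hd : 0 ≤ d) (hN : Fintype.card ι * d + 2 * w < κ)
    {A R : Fin 2 → ℤ} (hAR : Relation.ReflTransGen (CellStep Ω a κ) A R) :
    ∀ (p : ι → Fin 2 → ℝ) (n : ι → Fin 2 → ℤ), (∀ k, BoxInCell a κ w d (p k) (n k)) →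
    ∃ (q : ι → Fin 2 → ℝ) (n' : ι → Fin 2 → ℤ), BoxMove Ω d p q ∧ (∀ k, BoxInCell a κ w d (q k) (n' k)) ∧
      (∀ k, n k = A → n' k = R) ∧ (∀ k, n k = R → n' k = R) ∧
      ∀ k, Relation.ReflTransGen (CellStep Ω a κ) (n k) R →
        Relation.ReflTransGen (CellStep Ω a κ) (n' k) R := by
  induction hAR using Relation.ReflTransGen.head_induction_on with
  | refl => exact fun p n hpn => ⟨p, n, boxMove_refl _ _ _, hpn, fun _ h => h, fun _ h => h,
      fun _ h => h⟩
  | head hAB hBR ih =>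
    rename_i A B
    intro p n hpn
    -- If the chain returns to `R`, stop: a further step would carry the boxes already collected out
    -- of `R`.
    by_cases hA : A = R
    · subst hA
      exact ⟨p, n, boxMove_refl _ _ _, hpn, fun _ h => h, fun _ h => h, fun _ h => h⟩
    · obtain ⟨q, hq, hqn⟩ := exists_merge hκ hw hd hN hAB p n hpn
      obtain ⟨q', n', hq', hqn', h1, h2, h3⟩ := ih q _ hqn
      refine ⟨q', n', hq.trans hq', hqn', fun k hk => h1 k (if_pos hk), fun k hk => h2 k ?_,
        fun k hk => h3 k ?_⟩
      · rw [if_neg (by rw [hk]; exact fun h => hA h.symm), hk]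
      · split_ifs
        · exact hBR
        · exact hk

/-- If every occupied cell is linked to `R`, then all boxes can be moved to `R`. -/
theorem exists_gather {ι : Type*} [Fintype ι] {Ω : Set Plane} {a : Fin 2 → ℝ} {κ w d : ℝ}
    (hκ : 0 < κ) (hw : 0 < w) (hd : 0 ≤ d) (hN : Fintype.card ι * d + 2 * w < κ)
    {R : Fin 2 → ℤ} (p : ι → Fin 2 → ℝ) (n : ι → Fin 2 → ℤ)
    (hpn : ∀ k, BoxInCell a κ w d (p k) (n k))
    (hR : ∀ k, Relation.ReflTransGen (CellStep Ω a κ) (n k) R) :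
    ∃ q, BoxMove Ω d p q ∧ ∀ k, BoxInCell a κ w d (q k) R := by
  classical
  have key : ∀ s : Finset ι, ∃ (q : ι → Fin 2 → ℝ) (n' : ι → Fin 2 → ℤ), BoxMove Ω d p q ∧ (∀ k, BoxInCell a κ w d (q k) (n' k)) ∧
      (∀ k ∈ s, n' k = R) ∧ ∀ k, Relation.ReflTransGen (CellStep Ω a κ) (n' k) R := by
    intro s
    induction s using Finset.induction_on with
    | empty => exact ⟨p, n, boxMove_refl _ _ _, hpn, by simp, hR⟩
    | insert l s _ ih =>
      obtain ⟨q, n', hq, hqn, hs, hr⟩ := ih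
      obtain ⟨q', n'', hq', hqn', h1, h2, h3⟩ := exists_gather_cell hκ hw hd hN (hr l) q n' hqn
      refine ⟨q', n'', hq.trans hq', hqn', fun k hk => ?_, fun k => h3 k (hr k)⟩
      rcases Finset.mem_insert.1 hk with rfl | hk
      · exact h1 _ rfl
      · exact h2 k (hs k hk)
  obtain ⟨q, n', hq, hqn, hs, -⟩ := key Finset.univ
  exact ⟨q, hq, fun k => hs k (Finset.mem_univ k) ▸ hqn k⟩

/-! ### Chains of cells along a path -/

theorem exists_mem_gridCell (a : Fin 2 → ℝ) {κ : ℝ} (hκ : 0 < κ) (x : Plane) :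
    ∃ n, x ∈ gridCell a κ n := by
  refine ⟨fun i => ⌊(x i - a i) / κ⌋, fun i => ?_⟩
  have h1 := Int.floor_le ((x i - a i) / κ)
  have h2 := (Int.lt_floor_add_one ((x i - a i) / κ)).le
  rw [le_div_iff₀ hκ] at h1
  rw [div_le_iff₀ hκ] at h2
  constructor <;> linarith

/-- Cells are closed and the grid is locally finite, so cells missing `x` also miss a neighbourhood
of it. -/
theorem eventually_gridCell_subset (a : Fin 2 → ℝ) {κ : ℝ} (hκ : 0 < κ) (x : Plane) :
    ∀ᶠ y in nhds x, ∀ n, y ∈ gridCell a κ n → x ∈ gridCell a κ n := by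
  have h : ∀ i, ∀ᶠ y : Plane in nhds x, (⌈(x i - a i) / κ⌉ : ℝ) - 1 < (y i - a i) / κ ∧
      (y i - a i) / κ < ⌊(x i - a i) / κ⌋ + 1 := by
    intro i
    have hc : Continuous fun y : Plane => (y i - a i) / κ := by fun_prop
    exact (hc.tendsto x).eventually (Ioo_mem_nhds
      (by linarith [Int.ceil_lt_add_one ((x i - a i) / κ)]) (Int.lt_floor_add_one _))
  filter_upwards [Filter.eventually_all.2 h] with y hy n hn i
  obtain ⟨h1, h2⟩ := hn i
  obtain ⟨h3, h4⟩ := hy i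
  have h5 : (n i : ℝ) ≤ (y i - a i) / κ := by rw [le_div_iff₀ hκ]; linarith
  have h6 : (y i - a i) / κ ≤ n i + 1 := by rw [div_le_iff₀ hκ]; linarith
  have h7 : n i < ⌊(x i - a i) / κ⌋ + 1 := by exact_mod_cast h5.trans_lt h4
  have h8 : ⌈(x i - a i) / κ⌉ - 1 < n i + 1 := by
    rw [← Int.cast_lt (R := ℝ)]
    push_cast
    exact h3.trans_le h6
  have h9 : (n i : ℝ) ≤ (x i - a i) / κ := Int.le_floor.1 (by omega)
  have h10 : (x i - a i) / κ ≤ (n i + 1 : ℤ) := Int.ceil_le.1 (by omega)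
  rw [le_div_iff₀ hκ] at h9
  rw [div_le_iff₀ hκ] at h10
  push_cast at h10
  constructor <;> linarith

/-- Cells that contain a common point are linked. -/
theorem reflTransGen_cellStep_of_mem {Ω : Set Plane} {a : Fin 2 → ℝ} {κ : ℝ} (hκ : 0 < κ)
    {x : Plane} (hx : ∀ n, x ∈ gridCell a κ n → gridCell a κ n ⊆ Ω) {m m' : Fin 2 → ℤ}
    (hm : x ∈ gridCell a κ m) (hm' : x ∈ gridCell a κ m') :
    Relation.ReflTransGen (CellStep Ω a κ) m m' := by
  have hle : ∀ l l' : Fin 2 → ℤ, x ∈ gridCell a κ l → x ∈ gridCell a κ l' → ∀ i,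
      l i ≤ l' i + 1 := by
    intro l l' hl hl' i
    have h1 := (hl i).1
    have h2 := (hl' i).2
    have : κ * (l i : ℝ) ≤ κ * (l' i + 1) := by linarith
    exact_mod_cast le_of_mul_le_mul_left this hκ
  have one : ∀ l l' : Fin 2 → ℤ, x ∈ gridCell a κ l → x ∈ gridCell a κ l' → ∀ i,
      (∀ j ≠ i, l j = l' j) → Relation.ReflTransGen (CellStep Ω a κ) l l' := by
    intro l l' hl hl' i hi
    by_cases h : l i = l' i
    · have : l = l' := by
        ext j
        by_cases hj : j = i
        · rw [hj, h]
        · exact hi j hj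
      rw [this]
    · refine Relation.ReflTransGen.single ⟨hx l hl, hx l' hl', i, hi, ?_⟩
      have h1 := hle l l' hl hl' i
      have h2 := hle l' l hl' hl i
      omega
  -- Cells meeting only at a corner share no edge, so the chain passes through the cell with mixed
  -- indices, which also contains `x`.
  have hmid : x ∈ gridCell a κ (Function.update m 0 (m' 0)) := by
    intro i
    by_cases hi : i = 0
    · subst hi; simpa using hm' 0
    · simpa [hi] using hm i
  refine (one m _ hm hmid 0 fun j hj => by simp [hj]).trans (one _ m' hmid hm' 1 fun j hj => ?_)
  have : j = 0 := by omega
  subst this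
  simp

/-- The cells met by a path are linked. -/
theorem Path.reflTransGen_cellStep {Ω : Set Plane} {a : Fin 2 → ℝ} {κ : ℝ} (hκ : 0 < κ)
    {x y : Plane} (γ : Path x y) (hγ : ∀ t n, γ t ∈ gridCell a κ n → gridCell a κ n ⊆ Ω)
    {m m' : Fin 2 → ℤ} (hm : x ∈ gridCell a κ m) (hm' : y ∈ gridCell a κ m') :
    Relation.ReflTransGen (CellStep Ω a κ) m m' := by
  -- The times whose point lies in a cell reachable from `m` form a nonempty clopen set, hence
  -- everything.
  set U : Set unitInterval :=
    {t | ∃ l, γ t ∈ gridCell a κ l ∧ Relation.ReflTransGen (CellStep Ω a κ) m l} with hU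
  have hnear : ∀ t, ∀ᶠ s in nhds t, ∀ n, γ s ∈ gridCell a κ n → γ t ∈ gridCell a κ n :=
    fun t => (γ.continuous.tendsto t).eventually (eventually_gridCell_subset a hκ (γ t))
  have hopen : IsOpen U := by
    rw [isOpen_iff_eventually]
    rintro t ⟨l, hl, hml⟩
    filter_upwards [hnear t] with s hs
    obtain ⟨l', hl'⟩ := exists_mem_gridCell a hκ (γ s)
    exact ⟨l', hl', hml.trans (reflTransGen_cellStep_of_mem hκ (hγ t) hl (hs l' hl'))⟩
  have hclosed : IsClosed U := by
    rw [← isOpen_compl_iff, isOpen_iff_eventually]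
    intro t ht
    filter_upwards [hnear t] with s hs
    rintro ⟨l, hl, hml⟩
    exact ht ⟨l, hs l hl, hml⟩
  have huniv : U = univ := IsClopen.eq_univ ⟨hclosed, hopen⟩
    ⟨0, m, by rwa [γ.source], Relation.ReflTransGen.refl⟩
  obtain ⟨l, hl, hml⟩ : (1 : unitInterval) ∈ U := huniv ▸ mem_univ _
  exact hml.trans (reflTransGen_cellStep_of_mem hκ (hγ 1) hl (by rwa [γ.target]))

theorem dist_le_of_mem_gridCell {a : Fin 2 → ℝ} {κ : ℝ} {n : Fin 2 → ℤ} {x y : Plane}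
    (hx : x ∈ gridCell a κ n) (hy : y ∈ gridCell a κ n) : dist x y ≤ 2 * κ := by
  have h : ∀ i, |x i - y i| ≤ κ := fun i => by
    have h1 := hx i
    have h2 := hy i
    rw [abs_le]
    constructor <;> linarith
  linarith [dist_le_abs_add_abs x y, h 0, h 1]

/-! ### Choice of scales and assembly -/

/-- Since `δ * δ ^ (-s) = δ ^ (1 - s)`, the left side tends to 0; this is where `s < 1` enters. The
14 is twice the clearance `7 δ` of the grid offset, and `2 + C δ ^ (-s)` bounds one plus the number
of boxes. -/
theorem exists_small_mesh (C : ℝ) {s κ : ℝ} (hs : s < 1) (hκ : 0 < κ) :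
    ∃ δ : ℝ, 0 < δ ∧ 14 * δ * (2 + C * (δ⁻¹) ^ s) ≤ κ := by
  have hc : Filter.Tendsto (fun δ : ℝ => 14 * (2 * δ + C * δ ^ (1 - s))) (nhds 0)
      (nhds (14 * (2 * 0 + C * (0 : ℝ) ^ (1 - s)))) :=
    ((tendsto_const_nhds.mul Filter.tendsto_id).add (tendsto_const_nhds.mul
      (Real.continuousAt_rpow_const 0 (1 - s) (Or.inr (by linarith))))).const_mul 14
  rw [Real.zero_rpow (by linarith)] at hc
  have h1 : ∀ᶠ δ : ℝ in nhdsWithin 0 (Ioi 0), 14 * (2 * δ + C * δ ^ (1 - s)) < κ :=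
    (hc.eventually (gt_mem_nhds (by simpa using hκ))).filter_mono nhdsWithin_le_nhds
  obtain ⟨δ, hδ, hpos⟩ := (h1.and self_mem_nhdsWithin).exists
  refine ⟨δ, hpos, ?_⟩
  have : δ * (δ⁻¹) ^ s = δ ^ (1 - s) := by
    rw [Real.rpow_sub hpos, Real.rpow_one, Real.inv_rpow hpos.le, div_eq_mul_inv]
  calc 14 * δ * (2 + C * (δ⁻¹) ^ s) = 14 * (2 * δ + C * (δ * (δ⁻¹) ^ s)) := by ring
    _ ≤ κ := by rw [this]; exact hδ.le

/-- A continuous map that is a translation on each of finitely many sets is an isometry on every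
connected subset of their union. -/
theorem dist_eq_of_translates {ι : Type*} [Finite ι] {f : Plane → Plane} (hf : Continuous f)
    {Q : ι → Set Plane} (hQ : ∀ k, ∃ v, ∀ x ∈ Q k, f x = x + v) {D : Set Plane}
    (hD : IsPreconnected D) (hDQ : D ⊆ ⋃ k, Q k) {p q : Plane} (hp : p ∈ D) (hq : q ∈ D) :
    dist (f p) (f q) = dist p q := by
  choose v hv using hQ
  -- The displacement takes finitely many values on a connected set, so it is constant.
  have hc : IsPreconnected ((fun x => f x - x) '' D) :=
    hD.image _ (hf.sub continuous_id).continuousOn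
  have hfin : ((fun x => f x - x) '' D).Finite := by
    refine (Set.finite_range v).subset ?_
    rintro _ ⟨x, hx, rfl⟩
    obtain ⟨k, hk⟩ := mem_iUnion.1 (hDQ hx)
    exact ⟨k, by simp [hv k x hk]⟩
  have hsub : ((fun x => f x - x) '' D).Subsingleton := by
    by_contra hns
    exact hc.infinite_of_nontrivial (not_subsingleton_iff.1 hns) hfin
  have h : f p - p = f q - q := hsub ⟨p, hp, rfl⟩ ⟨q, hq, rfl⟩
  rw [dist_eq_norm, dist_eq_norm, sub_eq_sub_iff_sub_eq_sub.1 h]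

/-- The clearance `7 δ` splits into the half side `6 δ` of a box and the margin `w = δ`. Cells met
by the paths have diameter at most `2 κ < μ`, hence lie in `Ω`. -/
theorem exists_box_isotopy {ι : Type*} [Fintype ι] {Ω : Set Plane} (hΩ : IsOpen Ω)
    {κ μ δ : ℝ} (hδ : 0 < δ) (hκμ : 2 * κ < μ) (hcard : 14 * δ * (Fintype.card ι + 1) ≤ κ)
    (v : ι → Plane) (z : Plane)
    (hpath : ∀ k, ∃ γ : Path (v k) z, ∀ t, γ t ∈ Ω ∧ μ ≤ infDist (γ t) (frontier Ω)) :
    ∃ H, IsIsotopyIn Ω H ∧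
      (∀ t k, ∃ u : Plane, ∀ x, (∀ i, |x i - v k i| ≤ 6 * δ) → H t x = x + u) ∧
      ∀ k x, (∀ i, |x i - v k i| ≤ 6 * δ) → dist (H 1 x) z ≤ 2 * κ := by
  have hκ : 0 < κ := lt_of_lt_of_le (by positivity) hcard
  have hoff : ∀ i, ∃ a : ℝ, ∀ k, ∃ n : ℤ, a + κ * n + 7 * δ ≤ v k i ∧
      v k i + 7 * δ ≤ a + κ * n + κ := by
    intro i
    classical
    have hle : (Finset.univ.image fun k => v k i).card ≤ Fintype.card ι := Finset.card_image_le
    have hle' : ((Finset.univ.image fun k => v k i).card : ℝ) ≤ Fintype.card ι := by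
      exact_mod_cast hle
    obtain ⟨a, ha⟩ := exists_offset (Finset.univ.image fun k => v k i) (κ := κ) (h := 7 * δ)
      (by positivity) (by nlinarith)
    exact ⟨a, fun k => ha _ (Finset.mem_image_of_mem _ (Finset.mem_univ k))⟩
  choose a ha using hoff
  choose n hn using ha
  obtain ⟨R, hR⟩ := exists_mem_gridCell a hκ z
  have hbox : ∀ k x, (∀ i, |x i - v k i| ≤ 6 * δ) →
      x ∈ cornerBox (12 * δ) (fun i => v k i - 6 * δ) := by
    intro k x hx i
    have := abs_le.1 (hx i)
    constructor <;> linarith [this.1, this.2]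
  obtain ⟨q, ⟨H, hH, hHt, hH1⟩, hq⟩ := exists_gather (Ω := Ω) (a := a) (w := δ) (d := 12 * δ)
    (R := R) hκ hδ (by positivity) (by nlinarith) (fun k i => v k i - 6 * δ) (fun k i => n i k)
    (fun k i => by
      have := hn i k
      constructor <;> linarith [this.1, this.2])
    (fun k => by
      obtain ⟨γ, hγ⟩ := hpath k
      refine γ.reflTransGen_cellStep hκ (fun t m hm => ?_) (fun i => ?_) hR
      · refine Subset.trans (fun y hy => ?_)
          (ball_subset_of_le_infDist_frontier hΩ (hγ t).1 (hγ t).2)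
        exact (dist_le_of_mem_gridCell hy hm).trans_lt hκμ
      · have := hn i k
        constructor <;> linarith [this.1, this.2])
  refine ⟨H, hH, fun t k => ?_, fun k x hx => ?_⟩
  · obtain ⟨u, hu⟩ := hHt t k
    exact ⟨u, fun x hx => hu x (hbox k x hx)⟩
  · refine dist_le_of_mem_gridCell (a := a) (n := R) (fun i => ?_) hR
    have h1 := hH1 k x (hbox k x hx) i
    have h2 := hq k i
    constructor <;> linarith [h1.1, h1.2, h2.1, h2.2]

end

theorem proposition4p1 (C c s η ε : ℝ) (hC : 0 < C) (hc : 1 ≤ c) (hs₀ : 0 ≤ s) (hs₁ : s < 1)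
    (hη₀ : 0 < η) (hη₁ : η < 1) (hε : 0 < ε) :
    ∃ δ : ℝ, 0 < δ ∧ ∀ Ω : Set Plane, IsOpen Ω → IsConnected Ω → Metric.diam Ω = 1 → IsCigar c Ω →
      (∀ z ∈ Ω, ∀ w ∈ Ω, 2 * c * ε ≤ Metric.infDist z (frontier Ω) →
        2 * c * ε ≤ Metric.infDist w (frontier Ω) → DiskDeforms Ω ε z w) ∧
      ∀ X ⊆ Ω, IsHomogeneousSet C s X → ENNReal.ofReal η < setEDist X (frontier Ω) →
        squareThickening δ X ⊆ Ω ∧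
        ∀ z ∈ Ω, 2 * ε ≤ Metric.infDist z (frontier Ω) →
          ∃ H : unitInterval → LIP Ω, IsBiLipschitzPath H ∧
            (∀ p : Ω, (H 0).1 p = p) ∧
            (∀ p : Ω, (p : Plane) ∈ squareThickening δ X →
              ((H 1).1 p : Plane) ∈ Metric.ball z ε) ∧
            ∀ t : unitInterval, ∀ x ∈ squareThickening δ X, ∀ p q : Ω,
              (p : Plane) ∈ connectedComponentIn (squareThickening δ X) x →
              (q : Plane) ∈ connectedComponentIn (squareThickening δ X) x →
                dist ((H t).1 p) ((H t).1 q) = dist p q := by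
  have hc2 : 0 < (2 * c)⁻¹ := by positivity
  have hc2' : (2 * c)⁻¹ ≤ 2⁻¹ := inv_anti₀ two_pos (by linarith)
  -- Cigar paths from `X` to `z` keep distance `μ` from the frontier. As `μ ≤ ε`, mesh `μ / 3` makes
  -- the final cell lie in `B(z, ε)`.
  set μ : ℝ := (2 * c)⁻¹ * min η (2 * ε) with hμ
  have hmin : 0 < min η (2 * ε) := lt_min hη₀ (by linarith)
  have hμ0 : 0 < μ := mul_pos hc2 hmin
  have hμ1 : μ ≤ 2⁻¹ * min η (2 * ε) := mul_le_mul_of_nonneg_right hc2' hmin.le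
  have hμη : μ ≤ η / 2 := by linarith [min_le_left η (2 * ε)]
  have hμε : μ ≤ ε := by linarith [min_le_right η (2 * ε)]
  obtain ⟨δ, hδ, hδκ⟩ := exists_small_mesh C hs₁ (show 0 < μ / 3 by positivity)
  have hpow : 0 ≤ C * (δ⁻¹) ^ s := mul_nonneg hC.le (Real.rpow_nonneg (inv_nonneg.2 hδ.le) s)
  have hδη : 28 * δ ≤ μ / 3 := by nlinarith
  refine ⟨δ, hδ, fun Ω hΩ hconn hdiam hcigar => ⟨fun z hz w hw hzd hwd => ?_,
    fun X hXΩ hX hXd => ?_⟩⟩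
  · obtain ⟨γ, hγ, hγd⟩ := hcigar z hz w hw
    refine diskDeforms_of_path γ fun t => ball_subset_of_le_infDist_frontier hΩ (hγ t) ?_
    refine le_trans ?_ (hγd t)
    rw [le_inv_mul_iff₀ (by positivity)]
    exact le_min hzd hwd
  · have hbdd : Bornology.IsBounded Ω := by
      by_contra h
      rw [diam_eq_zero_of_unbounded h] at hdiam
      exact zero_ne_one hdiam
    have hfr : (frontier Ω).Nonempty := by
      rw [nonempty_frontier_iff]
      refine ⟨hconn.nonempty, fun h => ?_⟩
      rw [h] at hbdd
      exact NormedSpace.unbounded_univ ℝ Plane hbdd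
    have hXη : ∀ x ∈ X, η ≤ infDist x (frontier Ω) := fun x hx =>
      ofReal_lt_setEDist_infDist hfr hXd hx
    have hsub : squareThickening δ X ⊆ Ω := by
      intro p hp
      obtain ⟨x, hx, hpx⟩ := squareThickening_near hp
      refine ball_subset_of_le_infDist_frontier hΩ (hXΩ hx) (hXη x hx) ?_
      rw [mem_ball]
      linarith [dist_le_abs_add_abs p x, hpx 0, hpx 1]
    refine ⟨hsub, fun z hz hzd => ?_⟩
    obtain ⟨V, hVX, hVcard, hV⟩ := hX.exists_finite_net (hbdd.subset hXΩ) hC.le hs₀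
      ((diam_mono hXΩ hbdd).trans hdiam.le) hδ
    have hcov : ∀ p ∈ squareThickening δ X, ∃ v : V, ∀ i, |p i - (v : Plane) i| ≤ 6 * δ := by
      intro p hp
      obtain ⟨x, hx, hpx⟩ := squareThickening_near hp
      obtain ⟨v, hv, hxv⟩ := hV x hx
      refine ⟨⟨v, hv⟩, fun i => ?_⟩
      linarith [abs_sub_le (p i) (x i) (v i), abs_sub_le_dist x v i, hpx i]
    obtain ⟨H, hH, hHt, hH1⟩ := exists_box_isotopy (ι := V) hΩ (κ := μ / 3) (μ := μ) hδ
      (by linarith) (by rw [Fintype.card_coe]; nlinarith) (fun v => (v : Plane)) z (fun v => by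
        obtain ⟨γ, hγ, hγd⟩ := hcigar v (hXΩ (hVX v.2)) z hz
        exact ⟨γ, fun t => ⟨hγ t, le_trans (mul_le_mul_of_nonneg_left
          (min_le_min (hXη v (hVX v.2)) hzd) hc2.le) (hγd t)⟩⟩)
    obtain ⟨G, hG, hGH⟩ := hH.exists_restrict
    refine ⟨G, hG, fun p => Subtype.ext ?_, fun p hp => ?_, fun t x hx p q hp hq => ?_⟩
    · rw [hGH, hH.zero]
    · obtain ⟨v, hv⟩ := hcov p hp
      rw [hGH, mem_ball]
      linarith [hH1 v p hv]
    · rw [Subtype.dist_eq, Subtype.dist_eq, hGH, hGH]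
      refine dist_eq_of_translates (H t).continuous (hHt t) isPreconnected_connectedComponentIn
        (fun y hy => ?_) hp hq
      obtain ⟨v, hv⟩ := hcov y (connectedComponentIn_subset _ _ hy)
      exact mem_iUnion.2 ⟨v, hv⟩
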